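/- All quantum systems are finite-dimensional and logarithms are binary. Let $\mathcal{N}_{A\to\mathcal{B}\cup\mathcal{E}}$ be a quantum broadcast channel (a completely positive trace-preserving map) whose output is a finite family $\mathcal{B}\cup\mathcal{E}$ of systems, where the decoding set $\mathcal{B}$ (held by Bob) and the malicious set $\mathcal{E}$ (held by Eve) may overlap, and let $\varepsilon,\delta\in(0,1)$. An $(M,\varepsilon,\delta)$ entanglement-assisted (EA) private code, $M\in\mathbb{Z}^+$, consists of a state $\Psi_{RA'}$ on some systems $R,A'$, channels $\mathcal{E}^m_{A'\to A}$ and a POVM $\{\Lambda^m_{R\mathcal{B}}\}_m$ ($m=1,\dots,M$) such that, with $\rho^m_{R\mathcal{B}\cup\mathcal{E}}=\mathcal{N}(\mathcal{E}^m(\Psi_{RA'}))$, one has $\operatorname{Tr}\{(I-\Lambda^m_{R\mathcal{B}})\rho^m_{R\mathcal{B}}\}\le\varepsilon$ for all $m$, and there is a state $\sigma_{R\mathcal{E}}$ with $\frac12\|\rho^m_{R\mathcal{E}}-\sigma_{R\mathcal{E}}\|_1\le\delta$ for all $m$. The one-shot EA private capacity $C_{\mathrm{EP}}^{\varepsilon,\delta}(\mathcal{N})$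 is the largest value (supremum) of $\log_2 M$ over all $M$ for which an $(M,\varepsilon,\delta)$ code exists. For positive semidefinite $\omega,\tau$ put $F(\omega,\tau)=\|\sqrt\omega\sqrt\tau\|_1^2$, $D_{\min}(\omega\|\tau)=-\log_2F(\omega,\tau)$ and $D_{\max}(\omega\|\tau)=\inf\{\lambda\in\mathbb{R}:\omega\le2^\lambda\tau\}$. For $\rho_{AB}\ge0$ put $H_{\min}(A|B)_\rho=-\inf_{\sigma_B}D_{\max}(\rho_{AB}\|1_A\otimes\sigma_B)$ and $H_{\max}(A|B)_\rho=-\inf_{\sigma_B}D_{\min}(\rho_{AB}\|1_A\otimes\sigma_B)$, the infima being over density operators $\sigma_B$. For $\operatorname{Tr}\rho,\operatorname{Tr}\tau\le1$ let $P(\rho,\tau)=\sqrt{1-F(\rho\oplus[1-\operatorname{Tr}\rho],\tau\oplus[1-\operatorname{Tr}\tau])}$. For a state $\rho$ and $\eta\ge0$ let $H^\eta_{\min}(A|B)_\rho$ be the supremum of $H_{\min}(A|B)_{\bar\rho}$, and $H^\eta_{\max}(A|B)_\rho$ the infimum of $H_{\max}(A|B)_{\bar\rho}$, over all subnormalized states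 $\bar\rho$ with $P(\bar\rho,\rho)\le\eta$. All these quantities take values in $[-\infty,+\infty]$. Then $$C_{\mathrm{EP}}^{\varepsilon,\delta}(\mathcal{N})\le\sup_{\rho_{MRA}}\Big[H_{\min}^{\sqrt{2\delta}}(M|R\mathcal{E})_\omega-H_{\max}^{\sqrt{2\varepsilon}}(M|R\mathcal{B})_\omega\Big],$$ where the supremum is over all systems $M,R$ and all states $\rho_{MRA}$ that are classical on $M$ and quantum on $RA$, and $\omega_{MR\mathcal{B}\cup\mathcal{E}}=\mathcal{N}_{A\to\mathcal{B}\cup\mathcal{E}}(\rho_{MRA})$. -/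

import Mathlib

open scoped Kronecker ComplexOrder

namespace EAPrivate

noncomputable section

/-! Finite-dimensional quantum systems: the operators on a system with orthonormal basis indexed by
a finite type `α` are the matrices `Matrix α α ℂ`, and a composite system is indexed by a product. -/

section States

variable {α β : Type*} [Fintype α] [DecidableEq α] [Fintype β] [DecidableEq β]

/-- Density operators. -/
def IsDensity (ρ : Matrix α α ℂ) : Prop :=
  ρ.PosSemidef ∧ ρ.trace = 1

/-- Subnormalized density operators. -/
def IsSubDensity (ρ : Matrix α α ℂ) : Prop :=
  ρ.PosSemidef ∧ ρ.trace.re ≤ 1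

open scoped MatrixOrder in
/-- The positive square root of a positive semidefinite operator. -/
def psqrt (ρ : Matrix α α ℂ) : Matrix α α ℂ :=
  CFC.sqrt ρ

/-- The trace norm `Tr √(C† C)`. -/
def traceNorm (C : Matrix α α ℂ) : ℝ :=
  (psqrt (C.conjTranspose * C)).trace.re

/-- The fidelity `‖√ρ √σ‖₁ ^ 2`. -/
def fidelity (ρ σ : Matrix α α ℂ) : ℝ :=
  traceNorm (psqrt ρ * psqrt σ) ^ 2

/-- The embedding `ρ ↦ ρ ⊕ [1 - Tr ρ]`. -/
def extend (ρ : Matrix α α ℂ) : Matrix (α ⊕ Unit) (α ⊕ Unit) ℂ :=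
  Matrix.fromBlocks ρ 0 0 (Matrix.of fun _ _ => 1 - ρ.trace)

/-- The purified distance of subnormalized states. -/
def purifiedDist (ρ σ : Matrix α α ℂ) : ℝ :=
  Real.sqrt (1 - fidelity (extend ρ) (extend σ))

/-- The ball of subnormalized states around a state, in purified distance. -/
def ball (ε : ℝ) (ρ : Matrix α α ℂ) : Set (Matrix α α ℂ) :=
  {τ | IsSubDensity τ ∧ purifiedDist τ ρ ≤ ε}

/-- The binary logarithm on `[0, ∞)`, with `log₂ 0 = -∞`. -/
def log2 (x : ℝ) : EReal :=
  if x ≤ 0 then ⊥ else ((Real.logb 2 x : ℝ) : EReal)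

/-- `D_max(ω‖τ)`, the infimum of the real `l` with `ω ≤ 2 ^ l τ`, in `[-∞, ∞]`. -/
def dMax (ω τ : Matrix α α ℂ) : EReal :=
  ⨅ (l : ℝ) (_ : ((((2 : ℝ) ^ l : ℝ) : ℂ) • τ - ω).PosSemidef), (l : EReal)

/-- `D_min(ω‖τ) = -log₂ F(ω, τ)`. -/
def dMin (ω τ : Matrix α α ℂ) : EReal :=
  -log2 (fidelity ω τ)

/-- The conditional min-entropy `H_min(α|β)`. -/
def hMin (ρ : Matrix (α × β) (α × β) ℂ) : EReal :=
  -⨅ (σ : Matrix β β ℂ) (_ : IsDensity σ), dMax ρ ((1 : Matrix α α ℂ) ⊗ₖ σ)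

/-- The conditional max-entropy `H_max(α|β)`. -/
def hMax (ρ : Matrix (α × β) (α × β) ℂ) : EReal :=
  -⨅ (σ : Matrix β β ℂ) (_ : IsDensity σ), dMin ρ ((1 : Matrix α α ℂ) ⊗ₖ σ)

/-- The smoothed conditional min-entropy. -/
def hMinSmooth (ε : ℝ) (ρ : Matrix (α × β) (α × β) ℂ) : EReal :=
  ⨆ τ ∈ ball ε ρ, hMin τ

/-- The smoothed conditional max-entropy. -/
def hMaxSmooth (ε : ℝ) (ρ : Matrix (α × β) (α × β) ℂ) : EReal :=
  ⨅ τ ∈ ball ε ρ, hMax τ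

/-- The first system is classical: `ρ = ∑ m, |m⟩⟨m| ⊗ ρ_m` in the basis of that system. -/
def IsClassicalFst (ρ : Matrix (α × β) (α × β) ℂ) : Prop :=
  ∀ m m' x x', m ≠ m' → ρ (m, x) (m', x') = 0

end States

section Channels

/-- The map `id_κ ⊗ N`. -/
def ampl (κ : Type*) {α β : Type*} (N : Matrix α α ℂ →ₗ[ℂ] Matrix β β ℂ) :
    Matrix (κ × α) (κ × α) ℂ →ₗ[ℂ] Matrix (κ × β) (κ × β) ℂ where
  toFun ρ := Matrix.of fun p q => N (Matrix.of fun a a' => ρ (p.1, a) (q.1, a')) p.2 q.2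
  map_add' ρ σ := by
    ext p q
    exact congrFun (congrFun (N.map_add (Matrix.of fun a a' => ρ (p.1, a) (q.1, a'))
      (Matrix.of fun a a' => σ (p.1, a) (q.1, a'))) p.2) q.2
  map_smul' c ρ := by
    ext p q
    exact congrFun (congrFun (N.map_smul c (Matrix.of fun a a' => ρ (p.1, a) (q.1, a'))) p.2) q.2

/-- Quantum channels: completely positive trace-preserving linear maps. -/
def IsChannel {α β : Type*} [Fintype α] [Fintype β]
    (N : Matrix α α ℂ →ₗ[ℂ] Matrix β β ℂ) : Prop :=
  (∀ (k : ℕ) (ρ : Matrix (Fin k × α) (Fin k × α) ℂ), ρ.PosSemidef →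
      (ampl (Fin k) N ρ).PosSemidef) ∧
    ∀ ρ : Matrix α α ℂ, (N ρ).trace = ρ.trace

variable {ι : Type*} [DecidableEq ι] (X : ι → Type*)

/-- The basis of the composite of the systems `X i`, `i ∈ S`. -/
abbrev Sys (S : Finset ι) : Type _ :=
  ∀ i : {i // i ∈ S}, X i.1

/-- A basis vector of the systems in `T` and one of the systems in `S \ T` give one of those
in `S`, for `T ⊆ S`. -/
def glue {S T : Finset ι} (x : Sys X T) (z : Sys X (S \ T)) : Sys X S :=
  fun i => if h : i.1 ∈ T then x ⟨i.1, h⟩ else z ⟨i.1, Finset.mem_sdiff.mpr ⟨i.2, h⟩⟩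

/-- The partial trace over the systems in `S \ T`, for `T ⊆ S`. -/
def reduce [∀ i, Fintype (X i)] (S T : Finset ι) :
    Matrix (Sys X S) (Sys X S) ℂ →ₗ[ℂ] Matrix (Sys X T) (Sys X T) ℂ where
  toFun ρ := Matrix.of fun x y => ∑ z : Sys X (S \ T), ρ (glue X x z) (glue X y z)
  map_add' ρ σ := by
    ext x y
    simp [Finset.sum_add_distrib]
  map_smul' c ρ := by
    ext x y
    simp [Finset.mul_sum]

end Channels

section Codes

variable {ι : Type*} [DecidableEq ι] (X : ι → Type*) [∀ i, Fintype (X i)] [∀ i, DecidableEq (X i)]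
  (decSet malSet : Finset ι)
  {A : Type*} [Fintype A]

/-- An `(M, ε, δ)` entanglement-assisted private code for the broadcast channel `N`, whose outputs
in `decSet` are held by Bob and whose outputs in `malSet` are held by Eve. Both also hold `R`. -/
structure Code
    (N : Matrix A A ℂ →ₗ[ℂ] Matrix (Sys X (decSet ∪ malSet)) (Sys X (decSet ∪ malSet)) ℂ)
    (M : ℕ) (ε δ : ℝ) where
  /-- dimension of the share `R` of the assisting state -/
  dimR : ℕ
  /-- dimension of Alice's share `A'` of the assisting state -/
  dimA' : ℕ
  /-- the shared assisting state on `R A'` -/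
  assist : Matrix (Fin dimR × Fin dimA') (Fin dimR × Fin dimA') ℂ
  assist_density : IsDensity assist
  /-- encoding channels from `A'` to `A` -/
  enc : Fin M → (Matrix (Fin dimA') (Fin dimA') ℂ →ₗ[ℂ] Matrix A A ℂ)
  enc_channel : ∀ m, IsChannel (enc m)
  /-- the decoding measurement on `R` and Bob's systems -/
  povm : Fin M → Matrix (Fin dimR × Sys X decSet) (Fin dimR × Sys X decSet) ℂ
  povm_posSemidef : ∀ m, (povm m).PosSemidef
  povm_sum : ∑ m, povm m = 1
  reliable : ∀ m,
    ((1 - povm m) *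
      ampl (Fin dimR) (reduce X (decSet ∪ malSet) decSet)
        (ampl (Fin dimR) N (ampl (Fin dimR) (enc m) assist))).trace.re ≤ ε
  /-- the constant state of `R` and Eve's systems -/
  const : Matrix (Fin dimR × Sys X malSet) (Fin dimR × Sys X malSet) ℂ
  const_density : IsDensity const
  secure : ∀ m,
    1 / 2 * traceNorm
      (ampl (Fin dimR) (reduce X (decSet ∪ malSet) malSet)
        (ampl (Fin dimR) N (ampl (Fin dimR) (enc m) assist)) - const) ≤ δ

/-- The one-shot entanglement-assisted private capacity: the supremum, in `[-∞, ∞]`, of `log₂ M`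
over the positive integers `M` for which there is an `(M, ε, δ)` code. -/
def capacity
    (N : Matrix A A ℂ →ₗ[ℂ] Matrix (Sys X (decSet ∪ malSet)) (Sys X (decSet ∪ malSet)) ℂ)
    (ε δ : ℝ) : EReal :=
  ⨆ (M : ℕ) (_ : 0 < M) (_ : Nonempty (Code X decSet malSet N M ε δ)),
    ((Real.logb 2 M : ℝ) : EReal)

/-- The state of `M R` and the channel outputs in `T`, for the channel input state `ρ` on `M R A`. -/
def outState
    (N : Matrix A A ℂ →ₗ[ℂ] Matrix (Sys X (decSet ∪ malSet)) (Sys X (decSet ∪ malSet)) ℂ)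
    (T : Finset ι) {μ κ : Type*} (ρ : Matrix (μ × (κ × A)) (μ × (κ × A)) ℂ) :
    Matrix (μ × (κ × Sys X T)) (μ × (κ × Sys X T)) ℂ :=
  ampl μ (ampl κ (reduce X (decSet ∪ malSet) T)) (ampl μ (ampl κ N) ρ)

end Codes

end

end EAPrivate

/-!
A code gives the input state `ρ = (1 / M) ∑ m, |m⟩⟨m| ⊗ enc m (assist)`, for which the difference of
smoothed entropies is at least `log₂ M`; the two terms are bounded separately.

The secrecy condition puts `(1 / M) 1 ⊗ const` in the ball around Eve's state
(`logb_le_hMinSmooth`), and the min-entropy of that product is at least `log₂ M`. The distance is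
controlled by the Powers–Størmer inequality `Tr √ρ √σ ≥ 1 - ‖ρ - σ‖₁ / 2` (`one_sub_traceNorm_le`),
which gives `F ≥ (1 - δ)² ≥ 1 - 2 δ`.

For Bob, let `ω` be his state with the label and `L = ∑ m, |m⟩⟨m| ⊗ Λ m`. The reliability condition
says `Tr L ω ≥ 1 - ε`, so `L ω L` is in the ball around `ω` (`purifiedDist_conj_le`). Its root
fidelity with `1 ⊗ σ` is `‖√ω L √(1 ⊗ σ)‖₁ ≤ ‖√ω‖₂ ‖L √(1 ⊗ σ)‖₂ ≤ 1`, since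
`Tr L² (1 ⊗ σ) ≤ Tr L (1 ⊗ σ) = Tr (∑ m, Λ m) σ = 1`; hence its max-entropy is at most zero
(`hMaxSmooth_le_zero`). This bounds the smooth max-entropy directly, without duality or data
processing.

The trace norm inequalities rest on a polar decomposition (`exists_polar`).
-/

open Matrix

namespace EAPrivate

/-! ### Square roots, the trace norm and the fidelity -/

section TraceNorm

variable {α : Type*} [Fintype α] [DecidableEq α]

lemma posSemidef_psqrt (ρ : Matrix α α ℂ) : (psqrt ρ).PosSemidef := by
  open scoped MatrixOrder in
  exact Matrix.nonneg_iff_posSemidef.mp (CFC.sqrt_nonneg ρ)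

lemma conjTranspose_psqrt (ρ : Matrix α α ℂ) : (psqrt ρ)ᴴ = psqrt ρ :=
  (posSemidef_psqrt ρ).isHermitian

lemma psqrt_mul_psqrt {ρ : Matrix α α ℂ} (h : ρ.PosSemidef) : psqrt ρ * psqrt ρ = ρ := by
  open scoped MatrixOrder in
  exact CFC.sqrt_mul_sqrt_self ρ h.nonneg

lemma psqrt_eq {ρ b : Matrix α α ℂ} (hb : b.PosSemidef) (h : b * b = ρ) : psqrt ρ = b := by
  open scoped MatrixOrder in
  exact CFC.sqrt_unique h hb.nonneg

lemma traceNorm_nonneg (C : Matrix α α ℂ) : 0 ≤ traceNorm C :=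
  (Complex.le_def.mp (posSemidef_psqrt _).trace_nonneg).1

lemma re_trace_mul_nonneg {P Q : Matrix α α ℂ} (hP : P.PosSemidef) (hQ : Q.PosSemidef) :
    0 ≤ (P * Q).trace.re := by
  have h := (hQ.conjTranspose_mul_mul_same (psqrt P)).trace_nonneg
  rw [conjTranspose_psqrt, mul_assoc, trace_mul_comm, mul_assoc, psqrt_mul_psqrt hP,
    trace_mul_comm] at h
  exact (Complex.le_def.mp h).1

omit [DecidableEq α] in
lemma re_trace_conjTranspose (C : Matrix α α ℂ) : Cᴴ.trace.re = C.trace.re := by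
  rw [trace_conjTranspose]; simp

omit [DecidableEq α] in
/-- The arithmetic-geometric form of the Cauchy–Schwarz inequality for the Hilbert–Schmidt inner
product. -/
lemma two_mul_re_trace_le (Z Y : Matrix α α ℂ) :
    2 * (Zᴴ * Y).trace.re ≤ (Zᴴ * Z).trace.re + (Yᴴ * Y).trace.re := by
  have h := (Complex.le_def.mp (posSemidef_conjTranspose_mul_self (Z - Y)).trace_nonneg).1
  have h2 := re_trace_conjTranspose (Zᴴ * Y)
  simp only [conjTranspose_sub, conjTranspose_mul, conjTranspose_conjTranspose, sub_mul, mul_sub,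
    trace_sub, Complex.sub_re, Complex.zero_re] at h h2
  linarith

lemma posSemidef_one_sub_of_isProj {E : Matrix α α ℂ} (h : Eᴴ = E) (h2 : E * E = E) :
    (1 - E).PosSemidef := by
  have : 1 - E = (1 - E)ᴴ * (1 - E) := by
    simp [sub_mul, mul_sub, h, h2]
  rw [this]
  exact posSemidef_conjTranspose_mul_self _

lemma re_trace_mul_le_of_one_sub {P Q : Matrix α α ℂ} (hP : P.PosSemidef)
    (hQ : (1 - Q).PosSemidef) : (P * Q).trace.re ≤ P.trace.re := by
  have := re_trace_mul_nonneg hP hQ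
  rw [mul_sub, mul_one, trace_sub, Complex.sub_re] at this
  linarith

lemma continuousOn_spectrum (f : ℝ → ℝ) (T : Matrix α α ℂ) : ContinuousOn f (spectrum ℝ T) :=
  T.finite_real_spectrum.continuousOn f

/-- The Moore–Penrose inverse of a Hermitian matrix. -/
lemma exists_pseudoInverse {T : Matrix α α ℂ} (hT : T.IsHermitian) :
    ∃ G : Matrix α α ℂ, Gᴴ = G ∧ T * G = G * T ∧ T * G * T = T ∧ G * T * G = G := by
  have hc := fun f : ℝ → ℝ => continuousOn_spectrum f T
  have hT' : IsSelfAdjoint T := hT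
  have hid : cfc (fun x : ℝ => x) T = T := cfc_id' ℝ T
  refine ⟨cfc (fun x : ℝ => x⁻¹) T,
    (cfc_predicate (fun x : ℝ => x⁻¹) T : IsSelfAdjoint _), ?_, ?_, ?_⟩
  · have := (cfc_commute_cfc (R := ℝ) (fun x => x) (fun x => x⁻¹) T).eq
    rwa [hid] at this
  · have : cfc (fun x : ℝ => x * x⁻¹ * x) T = T * cfc (fun x : ℝ => x⁻¹) T * T := by
      rw [cfc_mul _ _ T (hc _) (hc _), cfc_mul _ _ T (hc _) (hc _), hid]
    rw [← this]
    convert hid using 3 with x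
    exact mul_inv_mul_cancel x
  · have : cfc (fun x : ℝ => x⁻¹ * x * x⁻¹) T =
        cfc (fun x : ℝ => x⁻¹) T * T * cfc (fun x : ℝ => x⁻¹) T := by
      rw [cfc_mul _ _ T (hc _) (hc _), cfc_mul _ _ T (hc _) (hc _), hid]
    rw [← this]
    congr 1
    ext x
    simpa using mul_inv_mul_cancel x⁻¹

/-- A polar decomposition with a partial isometry `K`, so that no completion to a unitary is
needed. -/
lemma exists_polar (C : Matrix α α ℂ) :
    ∃ K : Matrix α α ℂ, (1 - Kᴴ * K).PosSemidef ∧ (1 - K * Kᴴ).PosSemidef ∧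
      Kᴴ * C = psqrt (Cᴴ * C) ∧ K * psqrt (Cᴴ * C) = C := by
  have hTT := psqrt_mul_psqrt (posSemidef_conjTranspose_mul_self C)
  have hTH := conjTranspose_psqrt (Cᴴ * C)
  set T := psqrt (Cᴴ * C) with hT
  obtain ⟨G, hG, hc, h1, h2⟩ := exists_pseudoInverse (posSemidef_psqrt (Cᴴ * C)).isHermitian
  rw [← hT] at hc h1 h2
  -- `K = C G` works; `T G` is the projection onto the range of `T`, and `C` vanishes off it.
  have hKK : (C * G)ᴴ * (C * G) = T * G := by
    calc (C * G)ᴴ * (C * G) = G * (Cᴴ * C) * G := by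
          simp only [conjTranspose_mul, hG, mul_assoc]
      _ = (G * T) * (T * G) := by rw [← hTT]; simp only [mul_assoc]
      _ = T * G := by rw [← hc, ← mul_assoc, h1]
  have hCE : C * (T * G) = C := by
    have : (C - C * (T * G))ᴴ * (C - C * (T * G)) = 0 := by
      have e : (C - C * (T * G)) = C * (1 - T * G) := by rw [mul_sub, mul_one]
      have e2 : T * (1 - T * G) = 0 := by rw [mul_sub, mul_one, hc, ← mul_assoc, h1, sub_self]
      rw [e, conjTranspose_mul, mul_assoc, ← mul_assoc Cᴴ, ← hTT, mul_assoc T, e2]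
      simp
    exact (sub_eq_zero.mp (conjTranspose_mul_self_eq_zero.mp this)).symm
  refine ⟨C * G, ?_, ?_, ?_, ?_⟩
  · rw [hKK]
    apply posSemidef_one_sub_of_isProj
    · rw [conjTranspose_mul, hG, hTH, hc]
    · rw [← mul_assoc, h1]
  · apply posSemidef_one_sub_of_isProj
    · simp
    · rw [mul_assoc, ← mul_assoc (C * G)ᴴ, hKK, ← mul_assoc]
      congr 1
      rw [mul_assoc C, ← mul_assoc G, h2]
  · rw [conjTranspose_mul, hG, mul_assoc, ← hTT, ← mul_assoc, ← hc, h1]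
  · rw [mul_assoc, ← hc, hCE]

/-- Duality of the trace norm with the operator norm, the constraint `‖U‖ ≤ 1` being written as
`U * Uᴴ ≤ 1`. -/
lemma re_trace_mul_le_traceNorm {U : Matrix α α ℂ} (hU : (1 - U * Uᴴ).PosSemidef)
    (C : Matrix α α ℂ) : (U * C).trace.re ≤ traceNorm C := by
  obtain ⟨K, hK, -, -, hC⟩ := exists_polar C
  set T := psqrt (Cᴴ * C) with hT
  have hTp : T.PosSemidef := posSemidef_psqrt _
  set Q := psqrt T with hQ
  have hQQ : Q * Q = T := psqrt_mul_psqrt hTp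
  have hQH : Qᴴ = Q := conjTranspose_psqrt T
  -- `Tr U C = Tr (Uᴴ √T)ᴴ (K √T)` with `C = K T`, and both factors have `‖·‖₂² ≤ Tr T`.
  have h := two_mul_re_trace_le (Uᴴ * Q) (K * Q)
  have e1 : ((Uᴴ * Q)ᴴ * (K * Q)).trace = (U * C).trace := by
    rw [conjTranspose_mul, conjTranspose_conjTranspose, hQH, mul_assoc, trace_mul_comm, ← hC,
      ← hQQ]
    simp only [mul_assoc]
  have key : ∀ V : Matrix α α ℂ, (1 - Vᴴ * V).PosSemidef →
      ((V * Q)ᴴ * (V * Q)).trace.re ≤ traceNorm C := by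
    intro V hV
    have e : ((V * Q)ᴴ * (V * Q)).trace = (T * (Vᴴ * V)).trace := by
      rw [conjTranspose_mul, hQH, mul_assoc, trace_mul_comm, ← hQQ, trace_mul_comm (Q * Q)]
      simp only [mul_assoc]
    rw [e]
    exact re_trace_mul_le_of_one_sub hTp hV
  rw [e1] at h
  have h1 := key Uᴴ (by simpa using hU)
  have h2 := key K hK
  linarith

lemma re_trace_le_traceNorm (C : Matrix α α ℂ) : C.trace.re ≤ traceNorm C := by
  simpa using re_trace_mul_le_traceNorm (U := 1) (by simp [PosSemidef.zero]) C

/-- Hölder's inequality `‖X Y‖₁ ≤ ‖X‖₂ ‖Y‖₂` for factors of Hilbert–Schmidt norm at most one. -/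
lemma traceNorm_mul_le_one {X Y : Matrix α α ℂ} (hX : (X * Xᴴ).trace.re ≤ 1)
    (hY : (Yᴴ * Y).trace.re ≤ 1) : traceNorm (X * Y) ≤ 1 := by
  obtain ⟨K, -, hK, hC, -⟩ := exists_polar (X * Y)
  -- `‖X Y‖₁ = Tr Kᴴ X Y` is the Hilbert–Schmidt inner product of `Xᴴ K` and `Y`.
  have h := two_mul_re_trace_le (Xᴴ * K) Y
  have e1 : (Xᴴ * K)ᴴ * Y = psqrt ((X * Y)ᴴ * (X * Y)) := by
    rw [← hC, conjTranspose_mul, conjTranspose_conjTranspose, mul_assoc]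
  have e2 : ((Xᴴ * K)ᴴ * (Xᴴ * K)).trace = ((X * Xᴴ) * (K * Kᴴ)).trace := by
    rw [conjTranspose_mul, conjTranspose_conjTranspose, mul_assoc, trace_mul_comm]
    simp only [mul_assoc]
  have h2 := re_trace_mul_le_of_one_sub (posSemidef_self_mul_conjTranspose X) hK
  rw [e1, e2] at h
  unfold traceNorm
  linarith

/-- The absolute value `P` and the sign `U` of a Hermitian matrix. -/
lemma exists_abs_sign {D : Matrix α α ℂ} (hD : D.IsHermitian) :
    ∃ U P : Matrix α α ℂ, Uᴴ = U ∧ U * U = 1 ∧ U * D = P ∧ D * U = P ∧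
      (P - D).PosSemidef ∧ (P + D).PosSemidef := by
  open scoped MatrixOrder in
  have hc := fun f : ℝ → ℝ => continuousOn_spectrum f D
  have hD' : IsSelfAdjoint D := hD
  have hid : cfc (fun x : ℝ => x) D = D := cfc_id' ℝ D
  -- the sign takes the value `1` at `0`, so that it squares to one
  set s : ℝ → ℝ := fun x => if 0 ≤ x then 1 else -1 with hs
  refine ⟨cfc s D, cfc (fun x : ℝ => |x|) D, (cfc_predicate s D : IsSelfAdjoint _),
    ?_, ?_, ?_, ?_, ?_⟩
  · rw [← cfc_mul _ _ D (hc _) (hc _)]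
    have : (fun x => s x * s x) = fun _ => (1 : ℝ) := by
      ext x; by_cases h : 0 ≤ x <;> simp [hs, h]
    rw [this, cfc_const_one ℝ D]
  · have : (fun x : ℝ => |x|) = fun x => s x * x := by
      ext x
      by_cases h : 0 ≤ x
      · simp [hs, h]
      · simp [hs, h, abs_of_neg (not_le.mp h)]
    rw [this, cfc_mul _ _ D (hc _) (hc _), hid]
  · have : (fun x : ℝ => |x|) = fun x => x * s x := by
      ext x
      by_cases h : 0 ≤ x
      · simp [hs, h]
      · simp [hs, h, abs_of_neg (not_le.mp h)]
    rw [this, cfc_mul _ _ D (hc _) (hc _), hid]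
  · have : cfc (fun x : ℝ => |x| - x) D = cfc (fun x : ℝ => |x|) D - D := by
      rw [cfc_sub _ _ D (hc _) (hc _), hid]
    rw [← this]
    exact Matrix.nonneg_iff_posSemidef.mp (cfc_nonneg fun x _ => sub_nonneg.mpr (le_abs_self x))
  · have : cfc (fun x : ℝ => |x| + x) D = cfc (fun x : ℝ => |x|) D + D := by
      rw [cfc_add D _ _ (hc _) (hc _), hid]
    rw [← this]
    exact Matrix.nonneg_iff_posSemidef.mp
      (cfc_nonneg fun x _ => by linarith [neg_abs_le x])

/-- The Powers–Størmer inequality `‖√ρ - √σ‖₂² ≤ ‖ρ - σ‖₁`, for states: with `D = √ρ - √σ` and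
`S = √ρ + √σ` one has `2 (ρ - σ) = D S + S D`, and pairing with the sign of `D` gives
`Tr |D| S ≥ Tr D²` because `-S ≤ D ≤ S`. -/
lemma one_sub_traceNorm_le {ρ σ : Matrix α α ℂ} (hρ : IsDensity ρ) (hσ : IsDensity σ) :
    1 - 1 / 2 * traceNorm (ρ - σ) ≤ (psqrt ρ * psqrt σ).trace.re := by
  set a := psqrt ρ with ha
  set b := psqrt σ with hb
  have hap : a.PosSemidef := posSemidef_psqrt _
  have hbp : b.PosSemidef := posSemidef_psqrt _
  have haa : a * a = ρ := psqrt_mul_psqrt hρ.1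
  have hbb : b * b = σ := psqrt_mul_psqrt hσ.1
  obtain ⟨U, P, hU, hUU, h1, h2, h3, h4⟩ := exists_abs_sign (hap.isHermitian.sub hbp.isHermitian)
  have k1 := re_trace_mul_nonneg h3 hap
  have k2 := re_trace_mul_nonneg h4 hbp
  have k3 := re_trace_mul_le_traceNorm (U := U) (by rw [hU, hUU, sub_self]; exact .zero) (ρ - σ)
  have e : 2 * (U * (ρ - σ)).trace = (P * (a + b)).trace + (P * (a + b)).trace := by
    have e1 : (P * (a + b)).trace = (U * ((a - b) * (a + b))).trace := by rw [← h1, mul_assoc]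
    have e2 : (P * (a + b)).trace = (U * ((a + b) * (a - b))).trace := by
      rw [← h2, mul_assoc, trace_mul_comm, mul_assoc]
    have e3 : (a - b) * (a + b) + (a + b) * (a - b) = (2 : ℂ) • (ρ - σ) := by
      rw [← haa, ← hbb, two_smul]; noncomm_ring
    nth_rewrite 1 [e1]
    rw [e2, ← trace_add, ← mul_add, e3, mul_smul_comm, trace_smul, smul_eq_mul]
  have e' : (U * (ρ - σ)).trace.re = (P * (a + b)).trace.re := by
    have := congrArg Complex.re e
    simp at this
    linarith
  have t1 : (a * a).trace.re = 1 := by rw [haa, hρ.2]; rfl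
  have t2 : (b * b).trace.re = 1 := by rw [hbb, hσ.2]; rfl
  have t3 : (b * a).trace = (a * b).trace := trace_mul_comm _ _
  simp only [sub_mul, add_mul, mul_add, trace_sub, trace_add, Complex.sub_re, Complex.add_re, t1,
    t2, t3] at k1 k2 e'
  linarith

lemma fidelity_eq_of_conjTranspose_mul_self {P S B : Matrix α α ℂ} (hP : P = Bᴴ * B) :
    fidelity P S = traceNorm (B * psqrt S) ^ 2 := by
  have h : (psqrt P * psqrt S)ᴴ * (psqrt P * psqrt S) = (B * psqrt S)ᴴ * (B * psqrt S) := by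
    have hPP := psqrt_mul_psqrt (ρ := P) (hP ▸ posSemidef_conjTranspose_mul_self B)
    calc _ = psqrt S * (psqrt P * psqrt P) * psqrt S := by
          simp only [conjTranspose_mul, conjTranspose_psqrt, mul_assoc]
      _ = _ := by
          rw [hPP, hP]
          simp only [conjTranspose_mul, conjTranspose_psqrt, mul_assoc]
  rw [fidelity, traceNorm, traceNorm, h]

end TraceNorm

/-! ### The purified distance -/

section PurifiedDistance

variable {α : Type*} [Fintype α] [DecidableEq α]

omit [DecidableEq α] in
lemma trace_fromBlocks_zero (a : Matrix α α ℂ) :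
    (fromBlocks a 0 0 (0 : Matrix Unit Unit ℂ)).trace = a.trace := by
  simp [trace, Fintype.sum_sum_type]

lemma conjTranspose_psqrt_mul_mul_self {ω L : Matrix α α ℂ} (hω : ω.PosSemidef) (hL : Lᴴ = L) :
    (psqrt ω * L)ᴴ * (psqrt ω * L) = L * ω * L := by
  rw [conjTranspose_mul, hL, conjTranspose_psqrt, mul_assoc, ← mul_assoc (psqrt ω),
    psqrt_mul_psqrt hω, mul_assoc]

/-- For a state the weight `1 - Tr ρ` of the additional block vanishes. -/
lemma psqrt_extend {ρ : Matrix α α ℂ} (h : IsDensity ρ) :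
    psqrt (extend ρ) = fromBlocks (psqrt ρ) 0 0 0 := by
  apply psqrt_eq
  · have : fromBlocks (psqrt ρ) 0 0 (0 : Matrix Unit Unit ℂ) =
        (fromBlocks (psqrt (psqrt ρ)) 0 0 0)ᴴ * fromBlocks (psqrt (psqrt ρ)) 0 0 0 := by
      simp [fromBlocks_conjTranspose, fromBlocks_multiply, conjTranspose_psqrt,
        psqrt_mul_psqrt (posSemidef_psqrt ρ)]
    rw [this]
    exact posSemidef_conjTranspose_mul_self _
  · have : (Matrix.of fun _ _ => 0 : Matrix Unit Unit ℂ) = 0 := rfl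
    simp [extend, fromBlocks_multiply, psqrt_mul_psqrt h.1, h.2, this]

lemma purifiedDist_le_of_sq_le {ρ σ : Matrix α α ℂ} {ε : ℝ}
    (h : (1 - ε) ^ 2 ≤ fidelity (extend ρ) (extend σ)) :
    purifiedDist ρ σ ≤ Real.sqrt (2 * ε) :=
  Real.sqrt_le_sqrt (by nlinarith [sq_nonneg ε])

/-- One of the Fuchs–van de Graaf inequalities, for the purified distance: `1 - δ` bounds the
root fidelity `‖√ρ √σ‖₁` from below as soon as it bounds `Tr √ρ √σ`. -/
lemma purifiedDist_le_of_trace {ρ σ : Matrix α α ℂ} (hρ : IsDensity ρ) (hσ : IsDensity σ) {δ : ℝ}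
    (hδ : δ ≤ 1) (h : 1 - δ ≤ (psqrt ρ * psqrt σ).trace.re) :
    purifiedDist ρ σ ≤ Real.sqrt (2 * δ) := by
  apply purifiedDist_le_of_sq_le
  rw [fidelity, psqrt_extend hρ, psqrt_extend hσ]
  refine pow_le_pow_left₀ (by linarith) (h.trans ?_) 2
  rw [← trace_fromBlocks_zero, show fromBlocks (psqrt ρ * psqrt σ) 0 0 (0 : Matrix Unit Unit ℂ) =
    fromBlocks (psqrt ρ) 0 0 0 * fromBlocks (psqrt σ) 0 0 0 by simp [fromBlocks_multiply]]
  exact re_trace_le_traceNorm _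

/-- A form of the gentle measurement lemma: the root fidelity of `L ω L` and `ω` is at least
`Tr √ω L √ω = Tr L ω`. -/
lemma purifiedDist_conj_le {ω L : Matrix α α ℂ} (hω : IsDensity ω) (hL : Lᴴ = L)
    (ht : (L * ω * L).trace.re ≤ 1) {ε : ℝ} (hε : ε ≤ 1) (h : 1 - ε ≤ (L * ω).trace.re) :
    purifiedDist (L * ω * L) ω ≤ Real.sqrt (2 * ε) := by
  apply purifiedDist_le_of_sq_le
  have hpos : (L * ω * L).PosSemidef := by
    simpa [hL] using hω.1.conjTranspose_mul_mul_same L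
  set t := (L * ω * L).trace with hdt
  have htr : t = (t.re : ℂ) := by
    have := (Complex.le_def.mp hpos.trace_nonneg).2
    apply Complex.ext <;> simp
    exact this.symm
  set d : Matrix Unit Unit ℂ := Matrix.of fun _ _ => ((Real.sqrt (1 - t.re) : ℝ) : ℂ) with hd
  have hdd : dᴴ * d = Matrix.of fun _ _ => 1 - t := by
    ext i j
    simp only [hd, mul_apply, conjTranspose_apply, of_apply, Finset.univ_unique,
      Finset.sum_singleton]
    rw [htr]
    simp only [Complex.star_def, Complex.conj_ofReal, Complex.ofReal_re]
    rw [← Complex.ofReal_mul, Real.mul_self_sqrt (by linarith)]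
    push_cast; rfl
  have hP : extend (L * ω * L) = (fromBlocks (psqrt ω * L) 0 0 d)ᴴ *
      fromBlocks (psqrt ω * L) 0 0 d := by
    rw [fromBlocks_conjTranspose, fromBlocks_multiply,
      conjTranspose_psqrt_mul_mul_self hω.1 hL, hdd]
    simp [extend, hdt]
  rw [fidelity_eq_of_conjTranspose_mul_self hP, psqrt_extend hω]
  refine pow_le_pow_left₀ (by linarith) (h.trans ?_) 2
  have e : (L * ω).trace = (fromBlocks (psqrt ω * L) 0 0 d *
      fromBlocks (psqrt ω) 0 0 0).trace := by
    simp only [fromBlocks_multiply, Matrix.mul_zero, Matrix.zero_mul, add_zero]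
    rw [trace_fromBlocks_zero, trace_mul_comm (psqrt ω * L), ← mul_assoc,
      psqrt_mul_psqrt hω.1, trace_mul_comm]
  rw [e]
  exact re_trace_le_traceNorm _

end PurifiedDistance

/-! ### Classical-quantum states and their smooth entropies -/

section ClassicalQuantum

variable {μ β : Type*} [DecidableEq μ]

/-- The classical-quantum operator `∑ m, |m⟩⟨m| ⊗ f m`. -/
def cq (f : μ → Matrix β β ℂ) : Matrix (μ × β) (μ × β) ℂ :=
  Matrix.of fun p q => if p.1 = q.1 then f p.1 p.2 q.2 else 0

lemma cq_mul [Fintype μ] [Fintype β] (f g : μ → Matrix β β ℂ) :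
    cq f * cq g = cq fun m => f m * g m := by
  ext ⟨m, x⟩ ⟨m', y⟩
  simp only [cq, mul_apply, of_apply, Fintype.sum_prod_type, ite_mul, zero_mul, mul_ite, mul_zero]
  rw [Finset.sum_eq_single m]
  · by_cases h : m = m' <;> simp [h]
  · intro b _ hb
    simp [hb.symm]
  · simp

lemma cq_conjTranspose (f : μ → Matrix β β ℂ) : (cq f)ᴴ = cq fun m => (f m)ᴴ := by
  ext ⟨m, x⟩ ⟨m', y⟩
  by_cases h : m = m'
  · simp [cq, h]
  · simp [cq, h, Ne.symm h]

lemma cq_one [DecidableEq β] : cq (fun _ : μ => (1 : Matrix β β ℂ)) = 1 := by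
  ext ⟨m, x⟩ ⟨m', y⟩
  by_cases h : m = m' <;> simp [cq, h, one_apply]

lemma cq_sub (f g : μ → Matrix β β ℂ) : cq f - cq g = cq fun m => f m - g m := by
  ext ⟨m, x⟩ ⟨m', y⟩
  by_cases h : m = m' <;> simp [cq, h]

lemma one_kronecker_eq_cq (σ : Matrix β β ℂ) :
    (1 : Matrix μ μ ℂ) ⊗ₖ σ = cq fun _ => σ := by
  ext ⟨m, x⟩ ⟨m', y⟩
  by_cases h : m = m' <;> simp [cq, h, one_apply]

lemma isClassicalFst_cq (f : μ → Matrix β β ℂ) : IsClassicalFst (cq f) := by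
  intro m m' x x' h
  simp [cq, h]

variable [Fintype μ] [Fintype β]

lemma trace_cq (f : μ → Matrix β β ℂ) : (cq f).trace = ∑ m, (f m).trace := by
  simp [cq, trace, Fintype.sum_prod_type]

lemma posSemidef_cq {f : μ → Matrix β β ℂ} (h : ∀ m, (f m).PosSemidef) :
    (cq f).PosSemidef := by
  classical
  have : cq f = (cq fun m => psqrt (f m))ᴴ * cq fun m => psqrt (f m) := by
    rw [cq_conjTranspose, cq_mul]
    simp only [conjTranspose_psqrt, psqrt_mul_psqrt (h _)]
  rw [this]
  exact posSemidef_conjTranspose_mul_self _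

omit [Fintype β] in
lemma posSemidef_ofReal_smul {f : Matrix β β ℂ} (h : f.PosSemidef) {c : ℝ} (hc : 0 ≤ c) :
    ((c : ℂ) • f).PosSemidef :=
  h.smul (by exact_mod_cast hc)

/-- A uniform mixture of labelled states; the weight `1 / |μ|` is written as a square. -/
lemma isDensity_cq {f : μ → Matrix β β ℂ} (h : ∀ m, IsDensity (f m)) {c : ℝ}
    (hc : c ^ 2 * Fintype.card μ = 1) : IsDensity (cq fun m => ((c ^ 2 : ℝ) : ℂ) • f m) := by
  refine ⟨posSemidef_cq fun m => posSemidef_ofReal_smul (h m).1 (sq_nonneg c), ?_⟩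
  rw [trace_cq]
  simp only [trace_smul, (h _).2, smul_eq_mul, mul_one, Finset.sum_const, Finset.card_univ,
    nsmul_eq_mul]
  rw [mul_comm]
  exact_mod_cast hc

variable [DecidableEq β]

lemma psqrt_cq_smul {f : μ → Matrix β β ℂ} (h : ∀ m, (f m).PosSemidef) {c : ℝ} (hc : 0 ≤ c) :
    psqrt (cq fun m => ((c ^ 2 : ℝ) : ℂ) • f m) = cq fun m => (c : ℂ) • psqrt (f m) := by
  apply psqrt_eq (posSemidef_cq fun m => posSemidef_ofReal_smul (posSemidef_psqrt _) hc)
  rw [cq_mul]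
  congr 1
  ext m : 1
  rw [smul_mul_smul_comm, psqrt_mul_psqrt (h m)]
  push_cast
  rw [sq]

/-- If each `ρ m` is `δ`-close to a fixed state, then the uniform label is `√(2 δ)`-close to
uniform and independent of the quantum system. -/
lemma logb_le_hMinSmooth {ρ : μ → Matrix β β ℂ} {σ : Matrix β β ℂ} (hρ : ∀ m, IsDensity (ρ m))
    (hσ : IsDensity σ) {δ : ℝ} (hδ : δ ≤ 1) (h : ∀ m, 1 / 2 * traceNorm (ρ m - σ) ≤ δ)
    {c : ℝ} (hc0 : 0 ≤ c) (hc : c ^ 2 * Fintype.card μ = 1) :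
    ((Real.logb 2 (Fintype.card μ) : ℝ) : EReal) ≤
      hMinSmooth (Real.sqrt (2 * δ)) (cq fun m => ((c ^ 2 : ℝ) : ℂ) • ρ m) := by
  have hω := isDensity_cq hρ hc
  have hτ := isDensity_cq (fun _ : μ => hσ) hc
  have hmem : (cq fun _ : μ => ((c ^ 2 : ℝ) : ℂ) • σ) ∈
      ball (Real.sqrt (2 * δ)) (cq fun m => ((c ^ 2 : ℝ) : ℂ) • ρ m) := by
    refine ⟨⟨hτ.1, by rw [hτ.2]; simp⟩, purifiedDist_le_of_trace hτ hω hδ ?_⟩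
    rw [trace_mul_comm, psqrt_cq_smul (fun m => (hρ m).1) hc0,
      psqrt_cq_smul (fun _ : μ => hσ.1) hc0, cq_mul, trace_cq, Complex.re_sum]
    have : ∀ m, c ^ 2 * (1 - δ) ≤ ((c : ℂ) • psqrt (ρ m) * (c : ℂ) • psqrt σ).trace.re := by
      intro m
      have e : (c : ℂ) * c = ((c ^ 2 : ℝ) : ℂ) := by push_cast; ring
      rw [smul_mul_smul_comm, trace_smul, smul_eq_mul, e, Complex.re_ofReal_mul]
      refine mul_le_mul_of_nonneg_left ?_ (sq_nonneg c)
      linarith [one_sub_traceNorm_le (hρ m) hσ, h m]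
    calc 1 - δ = ∑ _m : μ, c ^ 2 * (1 - δ) := by
          rw [Finset.sum_const, Finset.card_univ, nsmul_eq_mul]
          linear_combination (-(1 - δ)) * hc
      _ ≤ _ := Finset.sum_le_sum fun m _ => this m
  refine le_iSup₂_of_le _ hmem ?_
  rw [hMin, EReal.le_neg]
  -- the optimal exponent in `D_max` is `-log₂ |μ|`, for which the two operators agree
  refine iInf₂_le_of_le σ hσ ?_
  refine iInf₂_le_of_le (-Real.logb 2 (Fintype.card μ)) ?_ le_rfl
  have hcard : (0 : ℝ) < Fintype.card μ := by
    by_contra h0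
    have : (Fintype.card μ : ℝ) = 0 := le_antisymm (not_lt.mp h0) (by positivity)
    rw [this] at hc
    simp at hc
  have e : ((2 : ℝ) ^ (-Real.logb 2 (Fintype.card μ)) : ℝ) = c ^ 2 := by
    rw [Real.rpow_neg (by norm_num), Real.rpow_logb (by norm_num) (by norm_num) hcard]
    exact (eq_inv_of_mul_eq_one_left hc).symm
  rw [e, one_kronecker_eq_cq]
  have : ((c ^ 2 : ℝ) : ℂ) • (cq fun _ : μ => σ) - (cq fun _ : μ => ((c ^ 2 : ℝ) : ℂ) • σ) = 0 := by
    ext ⟨m, x⟩ ⟨m', y⟩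
    simp [cq]
  rw [this]
  exact .zero

/-- If a measurement with effects `Λ m` guesses the label, then the post-measurement operator
`L ω L`, with `L = ∑ m, |m⟩⟨m| ⊗ Λ m`, is close to `ω`, and its root fidelity with `1 ⊗ σ` is
`‖√ω (L √(1 ⊗ σ))‖₁`, which is at most one because `Tr L² (1 ⊗ σ) ≤ ∑ m, Tr (Λ m) σ = 1`. -/
lemma hMaxSmooth_le_zero {ρ Λ : μ → Matrix β β ℂ} (hρ : ∀ m, IsDensity (ρ m))
    (hΛ : ∀ m, (Λ m).PosSemidef) (hsum : ∑ m, Λ m = 1) {ε : ℝ} (hε : ε ≤ 1)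
    (h : ∀ m, ((1 - Λ m) * ρ m).trace.re ≤ ε) {c : ℝ} (hc : c ^ 2 * Fintype.card μ = 1) :
    hMaxSmooth (Real.sqrt (2 * ε)) (cq fun m => ((c ^ 2 : ℝ) : ℂ) • ρ m) ≤ 0 := by
  have hω := isDensity_cq hρ hc
  set ω := cq fun m => ((c ^ 2 : ℝ) : ℂ) • ρ m with hdω
  set L := cq Λ with hdL
  have hLp : L.PosSemidef := posSemidef_cq hΛ
  have hLH : Lᴴ = L := hLp.isHermitian
  have hL1 : (1 - L).PosSemidef := by
    rw [hdL, ← cq_one, cq_sub]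
    refine posSemidef_cq fun m => ?_
    rw [← hsum, ← Finset.sum_erase_eq_sub (Finset.mem_univ m)]
    exact posSemidef_sum _ fun i _ => hΛ i
  -- `L - L² = L (1 - L) L + (1 - L) L (1 - L)`
  have hLL : (L - L * L).PosSemidef := by
    have e : L - L * L = Lᴴ * (1 - L) * L + (1 - L)ᴴ * L * (1 - L) := by
      rw [hL1.isHermitian.eq, hLH]; noncomm_ring
    rw [e]
    exact (hL1.conjTranspose_mul_mul_same L).add (hLp.conjTranspose_mul_mul_same (1 - L))
  have hle : ∀ τ : Matrix (μ × β) (μ × β) ℂ, τ.PosSemidef →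
      (L * L * τ).trace.re ≤ (L * τ).trace.re := by
    intro τ hτ
    have := re_trace_mul_nonneg hLL hτ
    rw [sub_mul, trace_sub, Complex.sub_re] at this
    linarith
  have ht : (L * ω * L).trace.re ≤ 1 := by
    rw [trace_mul_comm, ← mul_assoc]
    refine (hle ω hω.1).trans ?_
    rw [trace_mul_comm]
    refine (re_trace_mul_le_of_one_sub hω.1 hL1).trans ?_
    rw [hω.2]; simp
  have hmem : L * ω * L ∈ ball (Real.sqrt (2 * ε)) ω := by
    refine ⟨⟨by simpa [hLH] using hω.1.conjTranspose_mul_mul_same L, ht⟩,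
      purifiedDist_conj_le hω hLH ht hε ?_⟩
    rw [hdL, hdω, cq_mul, trace_cq, Complex.re_sum]
    have : ∀ m, c ^ 2 * (1 - ε) ≤ (Λ m * ((c ^ 2 : ℝ) : ℂ) • ρ m).trace.re := by
      intro m
      rw [mul_smul_comm, trace_smul, smul_eq_mul, Complex.re_ofReal_mul]
      refine mul_le_mul_of_nonneg_left ?_ (sq_nonneg c)
      have := h m
      rw [sub_mul, one_mul, trace_sub, (hρ m).2, Complex.sub_re, Complex.one_re] at this
      linarith
    calc 1 - ε = ∑ _m : μ, c ^ 2 * (1 - ε) := by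
          rw [Finset.sum_const, Finset.card_univ, nsmul_eq_mul]
          linear_combination (-(1 - ε)) * hc
      _ ≤ _ := Finset.sum_le_sum fun m _ => this m
  refine iInf₂_le_of_le _ hmem ?_
  rw [hMax, EReal.neg_le, neg_zero]
  refine le_iInf₂ fun σ hσ => ?_
  have hS : ((1 : Matrix μ μ ℂ) ⊗ₖ σ).PosSemidef := by
    rw [one_kronecker_eq_cq]; exact posSemidef_cq fun _ => hσ.1
  have hY : ((L * psqrt ((1 : Matrix μ μ ℂ) ⊗ₖ σ))ᴴ *
      (L * psqrt ((1 : Matrix μ μ ℂ) ⊗ₖ σ))).trace.re ≤ 1 := by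
    rw [conjTranspose_mul, conjTranspose_psqrt, hLH, mul_assoc, trace_mul_comm]
    have e : L * (L * psqrt ((1 : Matrix μ μ ℂ) ⊗ₖ σ)) * psqrt ((1 : Matrix μ μ ℂ) ⊗ₖ σ) =
        L * L * ((1 : Matrix μ μ ℂ) ⊗ₖ σ) := by
      rw [mul_assoc, mul_assoc, psqrt_mul_psqrt hS, mul_assoc]
    rw [e]
    refine (hle _ hS).trans ?_
    rw [one_kronecker_eq_cq, hdL, cq_mul, trace_cq, ← trace_sum, ← Finset.sum_mul, hsum, one_mul,
      hσ.2]
    simp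
  have hX : (psqrt ω * (psqrt ω)ᴴ).trace.re ≤ 1 := by
    rw [conjTranspose_psqrt, psqrt_mul_psqrt hω.1, hω.2]; simp
  have hF : fidelity (L * ω * L) ((1 : Matrix μ μ ℂ) ⊗ₖ σ) ≤ 1 := by
    rw [fidelity_eq_of_conjTranspose_mul_self
      (conjTranspose_psqrt_mul_mul_self hω.1 hLH).symm, mul_assoc]
    exact pow_le_one₀ (traceNorm_nonneg _) (traceNorm_mul_le_one hX hY)
  rw [dMin, EReal.le_neg, neg_zero, log2]
  split_ifs with h0
  · exact bot_le
  · exact_mod_cast Real.logb_nonpos (by norm_num) (not_le.mp h0).le hF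

end ClassicalQuantum

/-! ### Amplified channels and the partial trace -/

section Amplification

lemma trace_ampl {κ α β : Type*} [Fintype κ] [Fintype α] [Fintype β]
    {N : Matrix α α ℂ →ₗ[ℂ] Matrix β β ℂ} (hN : ∀ ρ, (N ρ).trace = ρ.trace)
    (ρ : Matrix (κ × α) (κ × α) ℂ) : (ampl κ N ρ).trace = ρ.trace := by
  have h : ∀ k, ∑ b, N (Matrix.of fun a a' => ρ (k, a) (k, a')) b b = ∑ a, ρ (k, a) (k, a) :=
    fun k => hN (Matrix.of fun a a' => ρ (k, a) (k, a'))
  simp only [trace, diag_apply, Fintype.sum_prod_type, ampl, LinearMap.coe_mk, AddHom.coe_mk,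
    of_apply, h]

lemma IsChannel.isDensity_ampl {k : ℕ} {α β : Type*} [Fintype α] [Fintype β]
    {N : Matrix α α ℂ →ₗ[ℂ] Matrix β β ℂ} (hN : IsChannel N)
    {ρ : Matrix (Fin k × α) (Fin k × α) ℂ} (hρ : IsDensity ρ) : IsDensity (ampl (Fin k) N ρ) :=
  ⟨hN.1 k ρ hρ.1, (trace_ampl hN.2 ρ).trans hρ.2⟩

lemma ampl_cq {μ β γ : Type*} [DecidableEq μ] (Φ : Matrix β β ℂ →ₗ[ℂ] Matrix γ γ ℂ)
    (f : μ → Matrix β β ℂ) : ampl μ Φ (cq f) = cq fun m => Φ (f m) := by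
  ext ⟨m, x⟩ ⟨m', y⟩
  by_cases h : m = m'
  · subst h
    simp only [ampl, cq, LinearMap.coe_mk, AddHom.coe_mk, of_apply, if_true]
    rfl
  · have : (Matrix.of fun a a' => cq f (m, a) (m', a')) = 0 := by
      ext a a'
      simp [cq, h]
    simp only [ampl, LinearMap.coe_mk, AddHom.coe_mk, of_apply, this, map_zero]
    simp [cq, h]

end Amplification

section PartialTrace

variable {ι : Type*} [DecidableEq ι] (X : ι → Type*)

lemma glue_bijective {S T : Finset ι} (h : T ⊆ S) :
    Function.Bijective fun p : Sys X T × Sys X (S \ T) => (glue X p.1 p.2 : Sys X S) := by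
  constructor
  · rintro ⟨x, z⟩ ⟨x', z'⟩ he
    ext i : 2
    · have := congrFun he ⟨i.1, h i.2⟩
      simpa [glue, i.2] using this
    · have hi := Finset.mem_sdiff.mp i.2
      have := congrFun he ⟨i.1, hi.1⟩
      simpa [glue, hi.2] using this
  · intro s
    refine ⟨(fun i => s ⟨i.1, h i.2⟩, fun i => s ⟨i.1, (Finset.mem_sdiff.mp i.2).1⟩), ?_⟩
    ext i
    by_cases hi : i.1 ∈ T <;> simp [glue, hi]

variable [∀ i, Fintype (X i)]

lemma trace_reduce {S T : Finset ι} (h : T ⊆ S) (ρ : Matrix (Sys X S) (Sys X S) ℂ) :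
    (reduce X S T ρ).trace = ρ.trace := by
  simp only [trace, diag_apply, reduce, LinearMap.coe_mk, AddHom.coe_mk, of_apply]
  rw [← Fintype.sum_prod_type' (f := fun x z => ρ (glue X x z) (glue X x z))]
  exact Fintype.sum_bijective _ (glue_bijective X h) _ _ fun _ => rfl

lemma isChannel_reduce {S T : Finset ι} (h : T ⊆ S) : IsChannel (reduce X S T) := by
  refine ⟨fun k ρ hρ => ?_, trace_reduce X h⟩
  have : ampl (Fin k) (reduce X S T) ρ =
      ∑ z : Sys X (S \ T), ρ.submatrix (fun p => (p.1, glue X p.2 z))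
        (fun p => (p.1, glue X p.2 z)) := by
    ext p q
    simp [ampl, reduce, Matrix.sum_apply]
  rw [this]
  exact posSemidef_sum _ fun z _ => hρ.submatrix _

end PartialTrace

end EAPrivate

/-! ### The capacity bound -/

open EAPrivate in
theorem theorem2 {ι : Type*} [DecidableEq ι] (X : ι → Type*) [∀ i, Fintype (X i)]
    [∀ i, DecidableEq (X i)] (decSet malSet : Finset ι)
    {A : Type*} [Fintype A]
    (N : Matrix A A ℂ →ₗ[ℂ] Matrix (EAPrivate.Sys X (decSet ∪ malSet))
      (EAPrivate.Sys X (decSet ∪ malSet)) ℂ)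
    (hN : EAPrivate.IsChannel N)
    (ε δ : ℝ) (hε : ε ∈ Set.Ioo (0 : ℝ) 1) (hδ : δ ∈ Set.Ioo (0 : ℝ) 1) :
    EAPrivate.capacity X decSet malSet N ε δ ≤
      ⨆ (m : ℕ) (r : ℕ) (ρ : Matrix (Fin m × (Fin r × A)) (Fin m × (Fin r × A)) ℂ)
        (_ : EAPrivate.IsDensity ρ) (_ : EAPrivate.IsClassicalFst ρ),
        (EAPrivate.hMinSmooth (Real.sqrt (2 * δ))
            (EAPrivate.outState X decSet malSet N malSet ρ) -
          EAPrivate.hMaxSmooth (Real.sqrt (2 * ε))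
            (EAPrivate.outState X decSet malSet N decSet ρ)) := by
  refine iSup_le fun M => iSup₂_le fun hM hC => ?_
  obtain ⟨C⟩ := hC
  obtain ⟨c, hc0, hc⟩ : ∃ c : ℝ, 0 ≤ c ∧ c ^ 2 * Fintype.card (Fin M) = 1 := by
    refine ⟨Real.sqrt ((M : ℝ)⁻¹), Real.sqrt_nonneg _, ?_⟩
    rw [Real.sq_sqrt (by positivity), Fintype.card_fin]
    exact inv_mul_cancel₀ (by positivity)
  have hin : ∀ m, IsDensity (ampl (Fin C.dimR) (C.enc m) C.assist) := fun m =>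
    (C.enc_channel m).isDensity_ampl C.assist_density
  have hout : ∀ T : Finset ι, T ⊆ decSet ∪ malSet → ∀ m,
      IsDensity (ampl (Fin C.dimR) (reduce X (decSet ∪ malSet) T)
        (ampl (Fin C.dimR) N (ampl (Fin C.dimR) (C.enc m) C.assist))) := fun T hT m =>
    (isChannel_reduce X hT).isDensity_ampl (hN.isDensity_ampl (hin m))
  have hstate : ∀ T : Finset ι, outState X decSet malSet N T
      (cq fun m => ((c ^ 2 : ℝ) : ℂ) • ampl (Fin C.dimR) (C.enc m) C.assist) =
      cq fun m => ((c ^ 2 : ℝ) : ℂ) • ampl (Fin C.dimR) (reduce X (decSet ∪ malSet) T)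
        (ampl (Fin C.dimR) N (ampl (Fin C.dimR) (C.enc m) C.assist)) := fun T => by
    rw [outState, ampl_cq, ampl_cq]
    simp only [map_smul]
  refine le_iSup_of_le M <| le_iSup_of_le C.dimR <|
    le_iSup_of_le (cq fun m => ((c ^ 2 : ℝ) : ℂ) • ampl (Fin C.dimR) (C.enc m) C.assist) <|
    le_iSup_of_le (isDensity_cq hin hc) <| le_iSup_of_le (isClassicalFst_cq _) ?_
  rw [hstate, hstate]
  have h1 := logb_le_hMinSmooth (hout malSet Finset.subset_union_right) C.const_density hδ.2.le
    C.secure hc0 hc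
  have h2 := hMaxSmooth_le_zero (hout decSet Finset.subset_union_left) C.povm_posSemidef C.povm_sum
    hε.2.le C.reliable hc
  rw [Fintype.card_fin] at h1
  simpa using EReal.sub_le_sub h1 h2
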